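/- Let $\theta>0$ and let $\pi\in S_N$ be drawn from the Mallows distribution, $P(\pi)=\theta^{c(\pi)}/\sum_{\rho\in S_N}\theta^{c(\rho)}$, where $c(\pi)$ is the number of inversions of $\pi$. Candidates are interviewed in the order $\pi_1,\dots,\pi_N$; a larger value means a better candidate, so the second-best candidate is the one with value $N-1$. For $1\le k_1\le k_2\le N-2$ the $(k_1,k_2)$-strategy selects the first candidate, at position $i$ say, such that either $i>k_1$ and $\pi_i$ is a left-to-right maximum (no earlier candidate is better), or $i>k_2$ and $\pi_i$ is a left-to-right second maximum (exactly one earlier candidate is better). It wins if the selected candidate is the second-best of all $N$ candidates. A pair $(k_1,k_2)$ with $1\le k_1\le k_2\le N-2$ is called best for $N$ if it maximizes the winning probability among all such pairs. Theorem. Let $\tfrac12<\theta<1$. (a) There is a constant $C$ depending only on $\theta$ such that for every $N$ and every best pair $(k_1,k_2)$ for $N$ one has $N-k_1\le C$ and $N-k_2\le C$. Moreover, there are integers $x\ge y\ge 2$ depending only on $\theta$ such that, for all sufficiently large $N$, the pair $(N-x,\,N-y)$ is best for $N$. (b) For all fixed integers $x\ge y\ge 2$, the winning probability of the $(N-x,N-y)$-strategy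 converges, as $N\to\infty$, to $$f(x,y)=\theta^{x-2}(1-\theta)\left(\theta^{y+1}+\theta^{y+1}(y-1)+\Big(x-y+1-\theta^{y-1}\,\frac{1-\theta^{x-y+1}}{1-\theta}\Big)+\theta\Big(\frac{1-\theta^{y-2}}{1-\theta}-\theta^{y-2}(y-2)\Big)\right).$$ -/

import Mathlib

open Filter Topology

/-- Number of inversions of a permutation of `N` elements: this is the Kendall distance to the
identity. -/
def inversionCount {N : ℕ} (π : Equiv.Perm (Fin N)) : ℕ :=
  (Finset.univ.filter fun p : Fin N × Fin N => p.1 < p.2 ∧ π p.2 < π p.1).card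

/-- Probability of the event `A` under the Mallows distribution with parameter `θ` on `S_N`, in
which a permutation `π` has weight `θ ^ (number of inversions of π)`. -/
noncomputable def mallowsProb (θ : ℝ) (N : ℕ) (A : Set (Equiv.Perm (Fin N))) : ℝ :=
  (∑ π : Equiv.Perm (Fin N), A.indicator (fun π => θ ^ inversionCount π) π) /
    ∑ π : Equiv.Perm (Fin N), θ ^ inversionCount π

/-- Positions and values are counted from `0`: `π i` is the quality of the `(i + 1)`-st candidate
interviewed, larger is better, so that the best candidate has value `N - 1` and the second-best
one has value `N - 2`. The candidate at `i` is a left-to-right maximum if no earlier one is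
better. -/
def IsLeftToRightMax {N : ℕ} (π : Equiv.Perm (Fin N)) (i : Fin N) : Prop :=
  ∀ j, j < i → π j < π i

/-- The candidate at `i` is a left-to-right second maximum if exactly one earlier candidate is
better. -/
def IsLeftToRightSecondMax {N : ℕ} (π : Equiv.Perm (Fin N)) (i : Fin N) : Prop :=
  ∃! j, j < i ∧ π i < π j

/-- The candidate at `i` is acceptable for the `(k₁, k₂)`-strategy: a left-to-right maximum that is
not among the first `k₁` candidates, or a left-to-right second maximum that is not among the first
`k₂` candidates. -/
def Acceptable {N : ℕ} (k₁ k₂ : ℕ) (π : Equiv.Perm (Fin N)) (i : Fin N) : Prop :=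
  (k₁ ≤ (i : ℕ) ∧ IsLeftToRightMax π i) ∨ (k₂ ≤ (i : ℕ) ∧ IsLeftToRightSecondMax π i)

/-- The `(k₁, k₂)`-strategy selects the first acceptable candidate (and nobody if there is none). -/
def Selects {N : ℕ} (k₁ k₂ : ℕ) (π : Equiv.Perm (Fin N)) (i : Fin N) : Prop :=
  Acceptable k₁ k₂ π i ∧ ∀ j, j < i → ¬ Acceptable k₁ k₂ π j

/-- The interview orders for which the `(k₁, k₂)`-strategy selects the second-best candidate. -/
def winningOrders (N k₁ k₂ : ℕ) : Set (Equiv.Perm (Fin N)) :=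
  {π | ∃ i : Fin N, Selects k₁ k₂ π i ∧ (π i : ℕ) + 2 = N}

/-- Probability that the `(k₁, k₂)`-strategy wins. -/
noncomputable def winProb (θ : ℝ) (N k₁ k₂ : ℕ) : ℝ :=
  mallowsProb θ N (winningOrders N k₁ k₂)

/-- The threshold pairs under consideration: `1 ≤ k₁ ≤ k₂ ≤ N - 2`. -/
def Admissible (N k₁ k₂ : ℕ) : Prop :=
  1 ≤ k₁ ∧ k₁ ≤ k₂ ∧ k₂ + 2 ≤ N

/-- `(k₁, k₂)` is a best pair of thresholds for `N` candidates. -/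
def IsBestThresholds (θ : ℝ) (N k₁ k₂ : ℕ) : Prop :=
  Admissible N k₁ k₂ ∧ ∀ j₁ j₂ : ℕ, Admissible N j₁ j₂ → winProb θ N j₁ j₂ ≤ winProb θ N k₁ k₂

/-- The limiting winning probability `f(x, y)`. -/
noncomputable def limitWinProb (θ : ℝ) (x y : ℤ) : ℝ :=
  θ ^ (x - 2) * (1 - θ) *
    (θ ^ (y + 1) + θ ^ (y + 1) * ((y : ℝ) - 1)
      + ((x : ℝ) - y + 1 - θ ^ (y - 1) * ((1 - θ ^ (x - y + 1)) / (1 - θ)))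
      + θ * ((1 - θ ^ (y - 2)) / (1 - θ) - θ ^ (y - 2) * ((y : ℝ) - 2)))

/-! Under the Mallows law the relative ranks of successive candidates are independent: a newcomer is
beaten by exactly `r` earlier candidates with probability proportional to `θ ^ r`. The strategy is
therefore a Markov chain whose states are: nobody selected, selection best so far, selection
second-best so far, selection already lost. The winning probability is the mass of the third state
(`winProb_eq_chainSecond`).

Over `s = N - k₁` steps this mass is `O(s² θ ^ s)` (`chain_bounds`), whereas `(N - 2, N - 2)` wins
with probability at least `(1 - θ)²` (`le_winProb_sub_two`); so best thresholds stay within a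
bounded distance of `N`. For fixed `x, y` the step probabilities tend to `1 - θ`, and solving the
limiting recursion (`chain_const`) gives `f`.

Limits alone would not break a tie in `f`. But for fixed `x, y` the winning probability is a
function of `q = θ ^ N`, analytic at `q = 0`, so a difference of two of them has constant weak sign
for small `q > 0` (`winProb_eventually_le_or_le`). Finitely many pairs compared in this way have an
eventual maximizer. -/

/-! ### Appending a last candidate of given relative rank -/

/-- The permutation of `n + 1` elements whose first `n` entries are in the same relative order as
those of `σ` and whose last entry is exceeded by exactly `r` others. -/
def insertLast {n : ℕ} (r : Fin (n + 1)) (σ : Equiv.Perm (Fin n)) : Equiv.Perm (Fin (n + 1)) :=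
  finSuccEquivLast.trans ((Equiv.optionCongr σ).trans (finSuccEquiv' r.rev).symm)

@[simp] theorem insertLast_last {n : ℕ} (r : Fin (n + 1)) (σ : Equiv.Perm (Fin n)) :
    insertLast r σ (Fin.last n) = r.rev := by
  simp [insertLast]

@[simp] theorem insertLast_castSucc {n : ℕ} (r : Fin (n + 1)) (σ : Equiv.Perm (Fin n))
    (i : Fin n) : insertLast r σ i.castSucc = r.rev.succAbove (σ i) := by
  simp [insertLast]

theorem insertLast_bijective (n : ℕ) :
    Function.Bijective fun p : Fin (n + 1) × Equiv.Perm (Fin n) => insertLast p.1 p.2 := by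
  rw [Fintype.bijective_iff_injective_and_card]
  constructor
  · rintro ⟨r, σ⟩ ⟨s, τ⟩ h
    have hr : r = s := by
      have := DFunLike.congr_fun h (Fin.last n)
      simpa using this
    subst hr
    refine Prod.ext rfl (Equiv.ext fun i => ?_)
    have := DFunLike.congr_fun h i.castSucc
    simpa using this
  · simp [Fintype.card_perm, Nat.factorial_succ]

/-- The weight thus factors as `θ ^ r` times the weight of `σ`, which is the independence of the
last relative rank from the past. -/
theorem inversionCount_insertLast {n : ℕ} (r : Fin (n + 1)) (σ : Equiv.Perm (Fin n)) :
    inversionCount (insertLast r σ) = inversionCount σ + r := by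
  have hr : (∑ i : Fin n, if r.rev < r.rev.succAbove (σ i) then 1 else 0) = (r : ℕ) := by
    rw [Equiv.sum_comp σ fun k => if r.rev < r.rev.succAbove k then 1 else 0]
    simp only [Fin.lt_succAbove_iff_le_castSucc, Fin.le_def, Fin.val_castSucc]
    rw [Fin.sum_univ_eq_sum_range (fun k => if (r.rev : ℕ) ≤ k then 1 else 0) n,
      ← Finset.card_filter]
    have : (Finset.range n).filter (fun k => (r.rev : ℕ) ≤ k) = Finset.Ico (r.rev : ℕ) n := by
      ext k; simp [and_comm]
    rw [this, Nat.card_Ico, Fin.val_rev]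
    omega
  unfold inversionCount
  simp only [Finset.card_filter, Fintype.sum_prod_type]
  rw [Fin.sum_univ_castSucc]
  simp only [Fin.sum_univ_castSucc (n := n), insertLast_castSucc, insertLast_last,
    Fin.castSucc_lt_castSucc_iff, Fin.succAbove_lt_succAbove_iff, Fin.castSucc_lt_last, true_and,
    lt_irrefl, false_and, if_false, Finset.sum_add_distrib, hr]
  simp [fun i : Fin n => (Fin.castSucc_lt_last i).not_gt]

theorem exists_fin_succ {n : ℕ} {p : Fin (n + 1) → Prop} :
    (∃ i, p i) ↔ (∃ i : Fin n, p i.castSucc) ∨ p (Fin.last n) := by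
  constructor
  · rintro ⟨i, hi⟩
    induction i using Fin.lastCases with
    | last => exact Or.inr hi
    | cast i => exact Or.inl ⟨i, hi⟩
  · rintro (⟨i, hi⟩ | h)
    exacts [⟨_, hi⟩, ⟨_, h⟩]

theorem isLeftToRightMax_iff_card {n : ℕ} (π : Equiv.Perm (Fin n)) (i : Fin n) :
    IsLeftToRightMax π i ↔ (Finset.univ.filter fun j => j < i ∧ π i < π j).card = 0 := by
  rw [Finset.card_eq_zero, Finset.filter_eq_empty_iff]
  unfold IsLeftToRightMax
  refine forall_congr' fun j => ?_
  simp only [Finset.mem_univ, true_implies, not_and, not_lt]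
  refine forall_congr' fun h => ?_
  have := (π.injective.ne h.ne)
  exact ⟨le_of_lt, fun h => lt_of_le_of_ne h this⟩

theorem isLeftToRightSecondMax_iff_card {n : ℕ} (π : Equiv.Perm (Fin n)) (i : Fin n) :
    IsLeftToRightSecondMax π i ↔
      (Finset.univ.filter fun j => j < i ∧ π i < π j).card = 1 := by
  rw [Finset.card_eq_one]
  simp only [Finset.eq_singleton_iff_unique_mem, Finset.mem_filter, Finset.mem_univ, true_and]
  rfl

theorem card_better_insertLast_castSucc {n : ℕ} (r : Fin (n + 1)) (σ : Equiv.Perm (Fin n))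
    (i : Fin n) :
    (Finset.univ.filter fun j => j < i.castSucc ∧
      insertLast r σ i.castSucc < insertLast r σ j).card =
    (Finset.univ.filter fun j => j < i ∧ σ i < σ j).card := by
  simp only [Finset.card_filter]
  rw [Fin.sum_univ_castSucc]
  simp [(Fin.castSucc_lt_last i).not_gt]

theorem card_better_insertLast_last {n : ℕ} (r : Fin (n + 1)) (σ : Equiv.Perm (Fin n)) :
    (Finset.univ.filter fun j => j < Fin.last n ∧
      insertLast r σ (Fin.last n) < insertLast r σ j).card = r := by
  have : (Finset.univ.filter fun j => j < Fin.last n ∧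
      insertLast r σ (Fin.last n) < insertLast r σ j) =
      (Finset.Ioi r.rev).map (insertLast r σ).symm.toEmbedding := by
    ext j
    simp only [insertLast_last, Finset.mem_filter, Finset.mem_univ, true_and, Finset.mem_map_equiv,
      Equiv.symm_symm, Finset.mem_Ioi, and_iff_right_iff_imp]
    intro h
    refine lt_of_le_of_ne (Fin.le_last j) ?_
    rintro rfl
    simp at h
  rw [this, Finset.card_map, Fin.card_Ioi, Fin.val_rev]
  omega

theorem acceptable_insertLast_castSucc {n k₁ k₂ : ℕ} (r : Fin (n + 1)) (σ : Equiv.Perm (Fin n))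
    (i : Fin n) : Acceptable k₁ k₂ (insertLast r σ) i.castSucc ↔ Acceptable k₁ k₂ σ i := by
  simp only [Acceptable, isLeftToRightMax_iff_card, isLeftToRightSecondMax_iff_card,
    card_better_insertLast_castSucc, Fin.val_castSucc]

theorem acceptable_insertLast_last {n k₁ k₂ : ℕ} (r : Fin (n + 1)) (σ : Equiv.Perm (Fin n)) :
    Acceptable k₁ k₂ (insertLast r σ) (Fin.last n) ↔
      (k₁ ≤ n ∧ (r : ℕ) = 0) ∨ (k₂ ≤ n ∧ (r : ℕ) = 1) := by
  simp only [Acceptable, isLeftToRightMax_iff_card, isLeftToRightSecondMax_iff_card,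
    card_better_insertLast_last, Fin.val_last]

/-- The interview orders in which the `(k₁, k₂)`-strategy selects nobody. -/
def unselectedOrders (n k₁ k₂ : ℕ) : Set (Equiv.Perm (Fin n)) :=
  {π | ∀ i, ¬ Acceptable k₁ k₂ π i}

/-- The interview orders in which the `(k₁, k₂)`-strategy selects the best candidate. -/
def bestSelectedOrders (n k₁ k₂ : ℕ) : Set (Equiv.Perm (Fin n)) :=
  {π | ∃ i, Selects k₁ k₂ π i ∧ (π i : ℕ) + 1 = n}

theorem selects_insertLast_castSucc {n k₁ k₂ : ℕ} (r : Fin (n + 1)) (σ : Equiv.Perm (Fin n))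
    (i : Fin n) : Selects k₁ k₂ (insertLast r σ) i.castSucc ↔ Selects k₁ k₂ σ i := by
  simp only [Selects, acceptable_insertLast_castSucc, Fin.forall_fin_succ',
    Fin.castSucc_lt_castSucc_iff]
  have : ¬ Fin.last n < i.castSucc := not_lt.2 (Fin.le_last _)
  simp [this]

theorem insertLast_mem_unselectedOrders {n k₁ k₂ : ℕ} (r : Fin (n + 1))
    (σ : Equiv.Perm (Fin n)) :
    insertLast r σ ∈ unselectedOrders (n + 1) k₁ k₂ ↔ σ ∈ unselectedOrders n k₁ k₂ ∧
      ¬ ((k₁ ≤ n ∧ (r : ℕ) = 0) ∨ (k₂ ≤ n ∧ (r : ℕ) = 1)) := by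
  simp only [unselectedOrders, Set.mem_ofPred_eq, Fin.forall_fin_succ',
    acceptable_insertLast_castSucc, acceptable_insertLast_last]

theorem selects_insertLast_last {n k₁ k₂ : ℕ} (r : Fin (n + 1)) (σ : Equiv.Perm (Fin n)) :
    Selects k₁ k₂ (insertLast r σ) (Fin.last n) ↔ σ ∈ unselectedOrders n k₁ k₂ ∧
      ((k₁ ≤ n ∧ (r : ℕ) = 0) ∨ (k₂ ≤ n ∧ (r : ℕ) = 1)) := by
  simp only [Selects, acceptable_insertLast_last, Fin.forall_fin_succ',
    acceptable_insertLast_castSucc, Fin.castSucc_lt_last, true_implies, lt_irrefl, false_implies,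
    and_true, unselectedOrders, Set.mem_ofPred_eq]
  exact and_comm

theorem val_succAbove_rev {n : ℕ} (r : Fin (n + 1)) (k : Fin n) :
    ((r.rev.succAbove k : Fin (n + 1)) : ℕ) = if (k : ℕ) + r < n then (k : ℕ) else k + 1 := by
  have := r.is_lt
  simp only [Fin.succAbove, Fin.lt_def, Fin.val_castSucc, Fin.val_rev]
  split_ifs <;> first | rfl | (exfalso; omega)

theorem insertLast_mem_bestSelectedOrders {n k₁ k₂ : ℕ} (r : Fin (n + 1))
    (σ : Equiv.Perm (Fin n)) :
    insertLast r σ ∈ bestSelectedOrders (n + 1) k₁ k₂ ↔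
      (σ ∈ bestSelectedOrders n k₁ k₂ ∧ (r : ℕ) ≠ 0) ∨
        (σ ∈ unselectedOrders n k₁ k₂ ∧ k₁ ≤ n ∧ (r : ℕ) = 0) := by
  simp only [bestSelectedOrders, Set.mem_ofPred_eq]
  rw [exists_fin_succ]
  simp only [selects_insertLast_castSucc, selects_insertLast_last, insertLast_castSucc,
    insertLast_last, val_succAbove_rev, Fin.val_rev]
  have hr := r.is_lt
  refine or_congr ?_ ?_
  · rw [← exists_and_right]
    refine exists_congr fun i => ?_
    rw [and_assoc]
    refine and_congr_right fun _ => ?_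
    have := (σ i).is_lt
    split_ifs <;> omega
  · rw [and_assoc]
    refine and_congr_right fun _ => ?_
    omega

/-- A selected second-best survives only a newcomer below it, a selected best drops to second
exactly when overtaken, and a newcomer selected on arrival is second-best exactly when `r = 1`. -/
theorem insertLast_mem_winningOrders {n k₁ k₂ : ℕ} (r : Fin (n + 1))
    (σ : Equiv.Perm (Fin n)) :
    insertLast r σ ∈ winningOrders (n + 1) k₁ k₂ ↔
      (σ ∈ winningOrders n k₁ k₂ ∧ 2 ≤ (r : ℕ)) ∨
        (σ ∈ bestSelectedOrders n k₁ k₂ ∧ (r : ℕ) = 0) ∨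
        (σ ∈ unselectedOrders n k₁ k₂ ∧ k₂ ≤ n ∧ (r : ℕ) = 1) := by
  simp only [winningOrders, bestSelectedOrders, Set.mem_ofPred_eq]
  rw [exists_fin_succ, ← or_assoc]
  simp only [selects_insertLast_castSucc, selects_insertLast_last, insertLast_castSucc,
    insertLast_last, val_succAbove_rev, Fin.val_rev]
  have hr := r.is_lt
  refine or_congr ?_ ?_
  · rw [← exists_and_right, ← exists_and_right, ← exists_or]
    refine exists_congr fun i => ?_
    rw [and_assoc, and_assoc, ← and_or_left]
    refine and_congr_right fun _ => ?_
    have := (σ i).is_lt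
    split_ifs <;> omega
  · rw [and_assoc]
    refine and_congr_right fun _ => ?_
    omega

/-! ### One-step recursion for Mallows probabilities -/

theorem sum_insertLast {n : ℕ} (g : Equiv.Perm (Fin (n + 1)) → ℝ) :
    ∑ π, g π = ∑ r : Fin (n + 1), ∑ σ : Equiv.Perm (Fin n), g (insertLast r σ) := by
  rw [← Fintype.sum_prod_type']
  exact ((insertLast_bijective n).sum_comp g).symm

/-- The probability that the last of `n + 1` candidates is the best one. -/
noncomputable def lastBestProb (θ : ℝ) (n : ℕ) : ℝ := (1 - θ) / (1 - θ ^ (n + 1))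

theorem mallowsProb_insertLast {θ : ℝ} (h₁ : θ < 1) {n : ℕ} (A : Set (Equiv.Perm (Fin (n + 1)))) :
    mallowsProb θ (n + 1) A = lastBestProb θ n *
      ∑ r : Fin (n + 1), θ ^ (r : ℕ) * mallowsProb θ n {σ | insertLast r σ ∈ A} := by
  have hg : ∑ r : Fin (n + 1), θ ^ (r : ℕ) = (1 - θ ^ (n + 1)) / (1 - θ) := by
    rw [Fin.sum_univ_eq_sum_range (fun k => θ ^ k), geom_sum_eq h₁.ne, ← neg_div_neg_eq]
    ring
  have hZ : ∑ π : Equiv.Perm (Fin (n + 1)), θ ^ inversionCount π =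
      (1 - θ ^ (n + 1)) / (1 - θ) * ∑ σ : Equiv.Perm (Fin n), θ ^ inversionCount σ := by
    rw [sum_insertLast, ← hg, Finset.sum_mul]
    simp only [inversionCount_insertLast, pow_add, Finset.mul_sum, mul_comm]
  have hA : ∑ π : Equiv.Perm (Fin (n + 1)), A.indicator (fun π => θ ^ inversionCount π) π =
      ∑ r : Fin (n + 1), θ ^ (r : ℕ) * ∑ σ : Equiv.Perm (Fin n),
        {σ | insertLast r σ ∈ A}.indicator (fun σ => θ ^ inversionCount σ) σ := by
    rw [sum_insertLast]
    refine Finset.sum_congr rfl fun r _ => ?_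
    rw [Finset.mul_sum]
    refine Finset.sum_congr rfl fun σ _ => ?_
    classical
    simp only [Set.indicator_apply, inversionCount_insertLast, pow_add, Set.mem_ofPred_eq]
    split_ifs <;> ring
  unfold mallowsProb lastBestProb
  simp only [hZ, hA, ← mul_div_assoc, ← Finset.sum_div]
  rw [div_mul_eq_div_div, div_div_eq_mul_div]
  ring

/-- Only the cases `r = 0`, `r = 1` and `r ≥ 2` matter to the strategy, so the geometric tail `r ≥
2` is lumped into one term. -/
theorem mallowsProb_succ {θ : ℝ} (h₀ : 0 < θ) (h₁ : θ < 1) {n : ℕ} (hn : 1 ≤ n)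
    (A : Set (Equiv.Perm (Fin (n + 1))))
    (B₀ B₁ B₂ : Set (Equiv.Perm (Fin n)))
    (hB : ∀ r σ, insertLast r σ ∈ A ↔
      (σ ∈ B₂ ∧ 2 ≤ (r : ℕ)) ∨ (σ ∈ B₀ ∧ (r : ℕ) = 0) ∨ (σ ∈ B₁ ∧ (r : ℕ) = 1)) :
    mallowsProb θ (n + 1) A =
      lastBestProb θ n * mallowsProb θ n B₀ + θ * lastBestProb θ n * mallowsProb θ n B₁ +
        (1 - (1 + θ) * lastBestProb θ n) * mallowsProb θ n B₂ := by
  obtain ⟨m, rfl⟩ := Nat.exists_eq_add_of_le' hn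
  have hne : 1 - θ ^ (m + 1 + 1) ≠ 0 :=
    (sub_pos.2 (pow_lt_one₀ h₀.le h₁ (by omega))).ne'
  have hg : ∑ r : Fin m, θ ^ (r : ℕ) = (1 - θ ^ m) / (1 - θ) := by
    rw [Fin.sum_univ_eq_sum_range (fun k => θ ^ k), geom_sum_eq h₁.ne, ← neg_div_neg_eq]
    ring
  rw [mallowsProb_insertLast h₁, Fin.sum_univ_succ, Fin.sum_univ_succ]
  simp only [hB]
  have h1 : 1 - θ ≠ 0 := (sub_pos.2 h₁).ne'
  have h2 : ∀ P : ℝ, ∑ r : Fin m, θ ^ ((r : ℕ) + 1 + 1) * P =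
      θ ^ 2 * ((1 - θ ^ m) / (1 - θ)) * P := by
    intro P
    rw [← hg, Finset.mul_sum, Finset.sum_mul]
    refine Finset.sum_congr rfl fun r _ => ?_
    ring
  simp [h2, lastBestProb]
  field_simp
  ring

/-! ### The Markov chain of the strategy -/

/-- With `ω s` the probability that the `s`-th of a sequence of candidates is a left-to-right
maximum and `θ * ω s` the probability that it is a left-to-right second maximum, independently of
the past, the probability that nobody has been selected after `s` candidates, if the second maxima
are acceptable from the time `t` on. -/
noncomputable def chainUnselected (θ : ℝ) (ω : ℕ → ℝ) (t : ℕ) : ℕ → ℝ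
  | 0 => 1
  | s + 1 => chainUnselected θ ω t s * (1 - ω s - if t ≤ s then θ * ω s else 0)

/-- The probability that after `s` candidates the selected one is the best so far. -/
noncomputable def chainBest (θ : ℝ) (ω : ℕ → ℝ) (t : ℕ) : ℕ → ℝ
  | 0 => 0
  | s + 1 => chainUnselected θ ω t s * ω s + chainBest θ ω t s * (1 - ω s)

/-- The probability that after `s` candidates the selected one is the second-best so far. -/
noncomputable def chainSecond (θ : ℝ) (ω : ℕ → ℝ) (t : ℕ) : ℕ → ℝ
  | 0 => 0
  | s + 1 => chainUnselected θ ω t s * (if t ≤ s then θ * ω s else 0) + chainBest θ ω t s * ω s +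
      chainSecond θ ω t s * (1 - (1 + θ) * ω s)

theorem mallowsProb_univ {θ : ℝ} (h₀ : 0 < θ) (n : ℕ) : mallowsProb θ n Set.univ = 1 := by
  unfold mallowsProb
  simp only [Set.indicator_univ]
  exact div_self (Finset.sum_pos (fun π _ => by positivity) Finset.univ_nonempty).ne'

theorem mallowsProb_empty (θ : ℝ) (n : ℕ) : mallowsProb θ n ∅ = 0 := by
  simp [mallowsProb]

theorem mallowsProb_eq_chain {θ : ℝ} (h₀ : 0 < θ) (h₁ : θ < 1) {k₁ k₂ : ℕ} (hk : 1 ≤ k₁)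
    (hk' : k₁ ≤ k₂) (s : ℕ) :
    mallowsProb θ (k₁ + s) (unselectedOrders (k₁ + s) k₁ k₂) =
      chainUnselected θ (fun j => lastBestProb θ (k₁ + j)) (k₂ - k₁) s ∧
    mallowsProb θ (k₁ + s) (bestSelectedOrders (k₁ + s) k₁ k₂) =
      chainBest θ (fun j => lastBestProb θ (k₁ + j)) (k₂ - k₁) s ∧
    mallowsProb θ (k₁ + s) (winningOrders (k₁ + s) k₁ k₂) =
      chainSecond θ (fun j => lastBestProb θ (k₁ + j)) (k₂ - k₁) s := by
  induction s with
  | zero =>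
    -- The chain starts at time `k₁`: since `k₁ ≤ k₂`, none of the first `k₁` candidates is
    -- acceptable.
    have hU : unselectedOrders (k₁ + 0) k₁ k₂ = Set.univ := by
      refine Set.eq_univ_of_forall fun π i h => ?_
      have := i.is_lt
      rcases h with h | h <;> omega
    have hS : ∀ (π : Equiv.Perm (Fin (k₁ + 0))) i, ¬ Selects k₁ k₂ π i := fun π i h =>
      (hU.symm ▸ Set.mem_univ π : π ∈ unselectedOrders (k₁ + 0) k₁ k₂) i h.1
    have hA : bestSelectedOrders (k₁ + 0) k₁ k₂ = ∅ :=
      Set.eq_empty_of_forall_notMem fun π ⟨i, h, _⟩ => hS π i h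
    have hB : winningOrders (k₁ + 0) k₁ k₂ = ∅ :=
      Set.eq_empty_of_forall_notMem fun π ⟨i, h, _⟩ => hS π i h
    rw [hU, hA, hB, mallowsProb_univ h₀, mallowsProb_empty]
    exact ⟨rfl, rfl, rfl⟩
  | succ s ih =>
    obtain ⟨hu, ha, hb⟩ := ih
    have hn : 1 ≤ k₁ + s := by omega
    have hs : k₂ - k₁ ≤ s ↔ k₂ ≤ k₁ + s := by omega
    rw [← add_assoc]
    simp only [chainUnselected, chainBest, chainSecond, ← hu, ← ha, ← hb, hs]
    refine ⟨?_, ?_, ?_⟩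
    · rw [mallowsProb_succ h₀ h₁ hn _ ∅ {σ | σ ∈ unselectedOrders (k₁ + s) k₁ k₂ ∧ ¬ k₂ ≤ k₁ + s}
        (unselectedOrders (k₁ + s) k₁ k₂), mallowsProb_empty]
      · split_ifs with h
        · simp [h, mallowsProb_empty]; ring
        · simp [h]; ring
      · intro r σ
        rw [insertLast_mem_unselectedOrders]
        simp only [Set.mem_empty_iff_false, Set.mem_ofPred_eq]
        by_cases hσ : σ ∈ unselectedOrders (k₁ + s) k₁ k₂
        · simp only [hσ, true_and, false_and, false_or]; omega
        · simp [hσ]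
    · rw [mallowsProb_succ h₀ h₁ hn _ (unselectedOrders (k₁ + s) k₁ k₂)
        (bestSelectedOrders (k₁ + s) k₁ k₂) (bestSelectedOrders (k₁ + s) k₁ k₂)]
      · ring
      · intro r σ
        rw [insertLast_mem_bestSelectedOrders]
        by_cases hσ : σ ∈ unselectedOrders (k₁ + s) k₁ k₂ <;>
        by_cases hτ : σ ∈ bestSelectedOrders (k₁ + s) k₁ k₂ <;>
        simp only [hσ, hτ, true_and, false_and, false_or, or_false] <;> omega
    · rw [mallowsProb_succ h₀ h₁ hn _ (bestSelectedOrders (k₁ + s) k₁ k₂)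
        {σ | σ ∈ unselectedOrders (k₁ + s) k₁ k₂ ∧ k₂ ≤ k₁ + s} (winningOrders (k₁ + s) k₁ k₂)]
      · split_ifs with h
        · simp [h]; ring
        · simp [h, mallowsProb_empty]; ring
      · intro r σ
        rw [insertLast_mem_winningOrders]
        simp only [Set.mem_ofPred_eq]
        tauto

theorem winProb_eq_chainSecond {θ : ℝ} (h₀ : 0 < θ) (h₁ : θ < 1) {k₁ k₂ : ℕ} (hk : 1 ≤ k₁)
    (hk' : k₁ ≤ k₂) (s : ℕ) : winProb θ (k₁ + s) k₁ k₂ =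
      chainSecond θ (fun j => lastBestProb θ (k₁ + j)) (k₂ - k₁) s :=
  (mallowsProb_eq_chain h₀ h₁ hk hk' s).2.2

/-! ### Exponential decay and the bound on best thresholds -/

theorem lastBestProb_bounds {θ : ℝ} (h₀ : 0 < θ) (h₁ : θ < 1) {n : ℕ} (hn : 1 ≤ n) :
    1 - θ ≤ lastBestProb θ n ∧ (1 + θ) * lastBestProb θ n ≤ 1 := by
  have h2 : θ ^ (n + 1) ≤ θ ^ 2 := pow_le_pow_of_le_one h₀.le h₁.le (by omega)
  have h3 : 0 < θ ^ (n + 1) := by positivity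
  have hpos : 0 < 1 - θ ^ (n + 1) := by nlinarith
  unfold lastBestProb
  rw [← mul_div_assoc, div_le_one hpos, le_div_iff₀ hpos]
  constructor <;> nlinarith

/-- Remaining in any of the three states costs a factor at most `θ`. A winning path changes state at
most twice (selection, then possibly being overtaken), so there are polynomially many choices of
times and at most two factors `θ` are lost. -/
theorem chain_bounds {θ : ℝ} (h₀ : 0 < θ) {ω : ℕ → ℝ} (hω : ∀ j, 1 - θ ≤ ω j)
    (h₁ : θ < 1) (hω' : ∀ j, (1 + θ) * ω j ≤ 1) (t s : ℕ) :
    (0 ≤ chainUnselected θ ω t s ∧ chainUnselected θ ω t s ≤ θ ^ s) ∧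
    (0 ≤ chainBest θ ω t s ∧ θ * chainBest θ ω t s ≤ s * θ ^ s) ∧
    (0 ≤ chainSecond θ ω t s ∧ θ ^ 2 * chainSecond θ ω t s ≤ s ^ 2 * θ ^ s) := by
  induction s with
  | zero => simp [chainUnselected, chainBest, chainSecond]
  | succ s ih =>
    obtain ⟨⟨hu, hu'⟩, ⟨ha, ha'⟩, ⟨hb, hb'⟩⟩ := ih
    have h1 := hω s
    have h2 := hω' s
    simp only [chainUnselected, chainBest, chainSecond]
    set u := chainUnselected θ ω t s
    set a := chainBest θ ω t s
    set b := chainSecond θ ω t s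
    set w := ω s
    set e := if t ≤ s then θ * w else 0
    have hw : 0 < w := by linarith
    have hw1 : w ≤ 1 := by nlinarith
    have he : 0 ≤ e := by simp only [e]; split_ifs <;> positivity
    have he' : e ≤ θ * w := by
      simp only [e]; split_ifs
      · exact le_rfl
      · positivity
    have hp : 0 < θ ^ s := by positivity
    have hw2 : 0 ≤ 1 - w := by linarith
    have hq : 0 ≤ 1 - (1 + θ) * w := by linarith
    have hq' : 1 - (1 + θ) * w ≤ θ := by nlinarith
    have hs : (0 : ℝ) ≤ s := s.cast_nonneg
    push_cast
    refine ⟨⟨mul_nonneg hu (by linarith), ?_⟩, ⟨by positivity, ?_⟩, ⟨by positivity, ?_⟩⟩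
    · calc u * (1 - w - e) ≤ θ ^ s * θ := mul_le_mul hu' (by linarith) (by linarith) hp.le
        _ = _ := (pow_succ _ _).symm
    · have i1 : u * w ≤ θ ^ s * 1 := mul_le_mul hu' hw1 hw.le hp.le
      have i2 : (θ * a) * (1 - w) ≤ (s * θ ^ s) * θ :=
        mul_le_mul ha' (by linarith) (by linarith) (by positivity)
      have i3 := mul_le_mul_of_nonneg_left i1 h₀.le
      rw [pow_succ]
      linarith
    · have i1 : u * e ≤ θ ^ s * θ := mul_le_mul hu' (by nlinarith) he hp.le
      have i2 : (θ * a) * w ≤ (s * θ ^ s) * 1 := mul_le_mul ha' hw1 hw.le (by positivity)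
      have i3 : (θ ^ 2 * b) * (1 - (1 + θ) * w) ≤ (s ^ 2 * θ ^ s) * θ :=
        mul_le_mul hb' hq' hq (by positivity)
      have j1 := mul_le_mul_of_nonneg_left i1 (sq_nonneg θ)
      have j2 := mul_le_mul_of_nonneg_left i2 h₀.le
      have j3 : θ ^ 2 * (θ ^ s * θ) ≤ θ ^ s * θ := by
        have : θ ^ 2 ≤ 1 := by nlinarith
        have h : 0 < θ ^ s * θ := by positivity
        nlinarith
      have j4 : 0 ≤ s * θ ^ s * θ := by positivity
      rw [pow_succ θ s]
      linarith

theorem le_winProb_sub_two {θ : ℝ} (h₀ : 0 < θ) (h₁ : θ < 1) {k : ℕ} (hk : 1 ≤ k) :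
    (1 - θ) ^ 2 ≤ winProb θ (k + 2) k k := by
  rw [winProb_eq_chainSecond h₀ h₁ hk le_rfl]
  have h2 := lastBestProb_bounds h₀ h₁ hk
  have h3 := lastBestProb_bounds h₀ h₁ (n := k + 1) (by omega)
  simp only [chainSecond, chainBest, chainUnselected, Nat.sub_self, le_refl, if_true, zero_le,
    add_zero]
  set a := lastBestProb θ k
  set b := lastBestProb θ (k + 1)
  have ha : 0 < a := by linarith [h2.1]
  have hb : 0 < b := by linarith [h3.1]
  -- Only one scenario is kept: the last two candidates are both left-to-right maxima, so the first
  -- of them is selected and then overtaken.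
  have i1 : (1 - θ) * (1 - θ) ≤ a * b := mul_le_mul h2.1 h3.1 (by linarith) ha.le
  have i2 : 0 ≤ θ * a * (1 - (1 + θ) * b) := mul_nonneg (by positivity) (by linarith [h3.2])
  have i3 : 0 ≤ (1 - a - θ * a) * (θ * b) := mul_nonneg (by linarith [h2.2]) (by positivity)
  linarith

theorem exists_bound_of_isBestThresholds {θ : ℝ} (h₀ : 0 < θ) (h₁ : θ < 1) :
    ∃ C : ℕ, ∀ N k₁ k₂ : ℕ, IsBestThresholds θ N k₁ k₂ → N ≤ k₁ + C ∧ N ≤ k₂ + C := by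
  have hlim : Tendsto (fun s : ℕ => (s : ℝ) ^ 2 * θ ^ s) atTop (𝓝 0) :=
    tendsto_pow_const_mul_const_pow_of_lt_one 2 h₀.le h₁
  have hc : 0 < θ ^ 2 * (1 - θ) ^ 2 := by
    have : 0 < 1 - θ := by linarith
    positivity
  obtain ⟨C, hC⟩ := eventually_atTop.1 (hlim.eventually_lt_const hc)
  refine ⟨C, fun N k₁ k₂ ⟨⟨h1, h2, h3⟩, hbest⟩ => ?_⟩
  suffices N ≤ k₁ + C by omega
  by_contra hN
  obtain ⟨s, rfl⟩ : ∃ s, N = k₁ + s := ⟨N - k₁, by omega⟩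
  obtain ⟨m, hm⟩ : ∃ m, k₁ + s = m + 2 := ⟨k₁ + s - 2, by omega⟩
  -- The competitor is the pair `(N - 2, N - 2)`.
  have hb := hbest m m ⟨by omega, le_rfl, by omega⟩
  rw [winProb_eq_chainSecond h₀ h₁ h1 h2] at hb
  have hlow := le_winProb_sub_two h₀ h₁ (k := m) (by omega)
  rw [← hm] at hlow
  have hup := (chain_bounds h₀ (fun j => (lastBestProb_bounds h₀ h₁ (n := k₁ + j) (by omega)).1) h₁
    (fun j => (lastBestProb_bounds h₀ h₁ (n := k₁ + j) (by omega)).2) (k₂ - k₁) s).2.2.2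
  have hlt := hC s (by omega)
  have := mul_le_mul_of_nonneg_left (hlow.trans hb) (sq_nonneg θ)
  linarith

/-! ### Dependence on `θ ^ N` and the limiting probability -/

/-- `lastBestProb θ (N - x + s)` as a function of `q = θ ^ N`. -/
noncomputable def shiftedProb (θ : ℝ) (x : ℕ) (q : ℝ) (s : ℕ) : ℝ :=
  (1 - θ) / (1 - q * (θ ^ (s + 1) / θ ^ x))

theorem winProb_sub_eq {θ : ℝ} (h₀ : 0 < θ) (h₁ : θ < 1) {N x y : ℕ} (hN : x < N) (hyx : y ≤ x) :
    winProb θ N (N - x) (N - y) = chainSecond θ (shiftedProb θ x (θ ^ N)) (x - y) x := by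
  obtain ⟨k, rfl⟩ : ∃ k, N = k + x := ⟨N - x, by omega⟩
  have h1 : k + x - x = k := by omega
  have h2 : k + x - y - k = x - y := by omega
  rw [h1, winProb_eq_chainSecond h₀ h₁ (by omega) (by omega), h2]
  congr 1
  funext s
  have : θ ^ x ≠ 0 := by positivity
  rw [lastBestProb, shiftedProb, pow_add θ k x, mul_assoc, mul_div_cancel₀ _ this, ← pow_add,
    add_assoc]

theorem analyticAt_chain {θ : ℝ} {ω : ℝ → ℕ → ℝ} {q₀ : ℝ}
    (hω : ∀ j, AnalyticAt ℝ (fun q => ω q j) q₀) (t s : ℕ) :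
    AnalyticAt ℝ (fun q => chainUnselected θ (ω q) t s) q₀ ∧
    AnalyticAt ℝ (fun q => chainBest θ (ω q) t s) q₀ ∧
    AnalyticAt ℝ (fun q => chainSecond θ (ω q) t s) q₀ := by
  induction s with
  | zero => exact ⟨analyticAt_const, analyticAt_const, analyticAt_const⟩
  | succ s ih =>
    obtain ⟨hu, ha, hb⟩ := ih
    have hw := hω s
    simp only [chainUnselected, chainBest, chainSecond]
    split_ifs <;> refine ⟨?_, ?_, ?_⟩ <;> fun_prop

theorem analyticAt_shiftedProb (θ : ℝ) (x j : ℕ) :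
    AnalyticAt ℝ (fun q => shiftedProb θ x q j) 0 := by
  unfold shiftedProb
  refine AnalyticAt.div (by fun_prop) (by fun_prop) (by simp)

/-- Survival costs `θ` per step before time `t` and `1 - (1 - θ) - θ(1 - θ) = θ²` after it. The
powers of `θ` on the left keep every identity polynomial. -/
theorem chain_const {θ : ℝ} (t m : ℕ) :
    chainUnselected θ (fun _ => 1 - θ) t (t + m) = θ ^ (t + 2 * m) ∧
    θ * chainBest θ (fun _ => 1 - θ) t (t + m) = θ ^ (t + m) * (t * (1 - θ) + 1 - θ ^ m) ∧
    θ ^ 3 * chainSecond θ (fun _ => 1 - θ) t (t + m) = θ ^ (t + m) * ((1 - θ) *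
      (t * θ - m * θ ^ m + m * θ ^ (m + 2)) + θ * (1 - θ ^ m) - θ ^ (m + 1) * (1 - θ ^ t)) := by
  have before : ∀ s ≤ t, chainUnselected θ (fun _ => 1 - θ) t s = θ ^ s ∧
      θ * chainBest θ (fun _ => 1 - θ) t s = θ ^ s * (s * (1 - θ)) ∧
      θ ^ 3 * chainSecond θ (fun _ => 1 - θ) t s =
        θ ^ s * ((1 - θ) * (s * θ) - θ * (1 - θ ^ s)) := by
    intro s hs
    induction s with
    | zero => simp [chainUnselected, chainBest, chainSecond]
    | succ s ih =>
      obtain ⟨hu, ha, hb⟩ := ih (by omega)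
      simp only [chainUnselected, chainBest, chainSecond, if_neg (show ¬ t ≤ s by omega), hu]
      push_cast
      refine ⟨by ring, ?_, ?_⟩
      · linear_combination θ * ha
      · linear_combination θ ^ 2 * (1 - θ) * ha + θ ^ 2 * hb
  induction m with
  | zero =>
    obtain ⟨hu, ha, hb⟩ := before t le_rfl
    refine ⟨by simpa using hu, ?_, ?_⟩
    · simp only [add_zero, ha]; ring
    · simp only [add_zero, hb]; push_cast; ring
  | succ m ih =>
    obtain ⟨hu, ha, hb⟩ := ih
    rw [← add_assoc]
    simp only [chainUnselected, chainBest, chainSecond, if_pos (show t ≤ t + m by omega), hu]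
    push_cast
    refine ⟨by ring, ?_, ?_⟩
    · linear_combination θ * ha
    · linear_combination θ ^ 2 * (1 - θ) * ha + θ ^ 2 * hb

theorem chainSecond_const_eq_limitWinProb {θ : ℝ} (h₀ : 0 < θ) (h₁ : θ < 1) {x y : ℕ}
    (hyx : y ≤ x) : chainSecond θ (fun _ => 1 - θ) (x - y) x = limitWinProb θ x y := by
  obtain ⟨t, rfl⟩ : ∃ t, x = t + y := ⟨x - y, by omega⟩
  have h := (chain_const (θ := θ) t y).2.2
  rw [Nat.add_sub_cancel]
  have h1 : 1 - θ ≠ 0 := (sub_pos.2 h₁).ne'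
  have h0 : θ ≠ 0 := h₀.ne'
  refine mul_left_cancel₀ (pow_ne_zero 3 h0) ?_
  rw [h, limitWinProb]
  have e1 : ((t + y : ℕ) : ℤ) - y + 1 = (t : ℤ) + 1 := by push_cast; ring
  rw [e1]
  simp only [Int.cast_natCast, zpow_add₀ h0, zpow_sub₀ h0, zpow_natCast, pow_add, zpow_ofNat,
    Nat.cast_add, Int.cast_add]
  field_simp
  ring

theorem tendsto_winProb {θ : ℝ} (h₀ : 0 < θ) (h₁ : θ < 1) {x y : ℕ} (hyx : y ≤ x) :
    Tendsto (fun N : ℕ => winProb θ N (N - x) (N - y)) atTop (𝓝 (limitWinProb θ x y)) := by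
  have hcont := (analyticAt_chain (θ := θ) (analyticAt_shiftedProb θ x)
    (x - y) x).2.2.continuousAt.tendsto
  have h := hcont.comp (tendsto_pow_atTop_nhds_zero_of_lt_one h₀.le h₁)
  have h0 : shiftedProb θ x 0 = fun _ => 1 - θ := by
    funext s; simp [shiftedProb]
  simp only [h0, chainSecond_const_eq_limitWinProb h₀ h₁ hyx] at h
  refine h.congr' ?_
  filter_upwards [eventually_gt_atTop x] with N hN
  exact (winProb_sub_eq h₀ h₁ hN hyx).symm

/-! ### Eventual comparison of pairs and the eventual maximizer -/

theorem AnalyticAt.eventually_nonneg_or_nonpos {f : ℝ → ℝ} (hf : AnalyticAt ℝ f 0) :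
    (∀ᶠ z in 𝓝[>] 0, 0 ≤ f z) ∨ ∀ᶠ z in 𝓝[>] 0, f z ≤ 0 := by
  by_cases h : ∀ᶠ z in 𝓝 0, f z = 0
  · exact Or.inl (nhdsWithin_le_nhds (h.mono fun z hz => hz.ge))
  -- Near `0` one has `f z = z ^ n * g z` with `g 0 ≠ 0`, so to the right of `0` the sign of `f` is
  -- that of `g 0`.
  · obtain ⟨n, g, hg, hg0, hfg⟩ := hf.exists_eventuallyEq_pow_smul_nonzero_iff.2 h
    have hfg' := nhdsWithin_le_nhds (s := Set.Ioi (0 : ℝ)) hfg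
    rcases hg0.lt_or_gt with h0 | h0
    · right
      have := nhdsWithin_le_nhds (s := Set.Ioi (0 : ℝ)) (hg.continuousAt.eventually_lt_const h0)
      filter_upwards [hfg', this, self_mem_nhdsWithin] with z h1 h2 h3
      rw [h1, sub_zero, smul_eq_mul]
      exact mul_nonpos_of_nonneg_of_nonpos (pow_nonneg (le_of_lt h3) n) h2.le
    · left
      have := nhdsWithin_le_nhds (s := Set.Ioi (0 : ℝ)) (hg.continuousAt.eventually_const_lt h0)
      filter_upwards [hfg', this, self_mem_nhdsWithin] with z h1 h2 h3
      rw [h1, sub_zero, smul_eq_mul]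
      exact mul_nonneg (pow_nonneg (le_of_lt h3) n) h2.le

theorem winProb_eventually_le_or_le {θ : ℝ} (h₀ : 0 < θ) (h₁ : θ < 1) {x y x' y' : ℕ}
    (hyx : y ≤ x) (hyx' : y' ≤ x') :
    (∀ᶠ N : ℕ in atTop, winProb θ N (N - x) (N - y) ≤ winProb θ N (N - x') (N - y')) ∨
    ∀ᶠ N : ℕ in atTop, winProb θ N (N - x') (N - y') ≤ winProb θ N (N - x) (N - y) := by
  have hlim : Tendsto (fun N : ℕ => θ ^ N) atTop (𝓝[>] 0) :=
    tendsto_nhdsWithin_iff.2 ⟨tendsto_pow_atTop_nhds_zero_of_lt_one h₀.le h₁,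
      Eventually.of_forall fun N => pow_pos h₀ N⟩
  have hF := (analyticAt_chain (θ := θ) (analyticAt_shiftedProb θ x) (x - y) x).2.2
  have hF' := (analyticAt_chain (θ := θ) (analyticAt_shiftedProb θ x') (x' - y') x').2.2
  refine (hF'.sub hF).eventually_nonneg_or_nonpos.imp (fun h => ?_) fun h => ?_ <;>
  · filter_upwards [hlim.eventually h, eventually_gt_atTop x, eventually_gt_atTop x']
      with N h1 h2 h3
    rw [winProb_sub_eq h₀ h₁ h2 hyx, winProb_sub_eq h₀ h₁ h3 hyx']
    simpa using h1

theorem exists_eventually_forall_le {ι : Type*} {s : Finset ι} (hs : s.Nonempty)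
    (g : ι → ℕ → ℝ) (htot : ∀ i ∈ s, ∀ j ∈ s, g i ≤ᶠ[atTop] g j ∨ g j ≤ᶠ[atTop] g i) :
    ∃ i ∈ s, ∀ᶠ N in atTop, ∀ j ∈ s, g j N ≤ g i N := by
  suffices ∃ i ∈ s, ∀ j ∈ s, g j ≤ᶠ[atTop] g i by
    obtain ⟨i, hi, h⟩ := this
    exact ⟨i, hi, (Finset.eventually_all s).2 h⟩
  induction hs using Finset.Nonempty.cons_induction with
  | singleton a => exact ⟨a, by simp, by simp [EventuallyLE.refl]⟩
  | cons a s ha hs ih =>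
    obtain ⟨i, hi, h⟩ := ih fun i hi j hj =>
      htot i (Finset.mem_cons_of_mem hi) j (Finset.mem_cons_of_mem hj)
    rcases htot a (Finset.mem_cons_self _ _) i (Finset.mem_cons_of_mem hi) with hai | hia
    · refine ⟨i, Finset.mem_cons_of_mem hi, fun j hj => ?_⟩
      rcases Finset.mem_cons.1 hj with rfl | hj
      exacts [hai, h j hj]
    · refine ⟨a, Finset.mem_cons_self _ _, fun j hj => ?_⟩
      rcases Finset.mem_cons.1 hj with rfl | hj
      exacts [EventuallyLE.refl _ _, (h j hj).trans hia]

theorem exists_isBestThresholds (θ : ℝ) {N : ℕ} (hN : 3 ≤ N) :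
    ∃ k₁ k₂, IsBestThresholds θ N k₁ k₂ := by
  have hfin : {p : ℕ × ℕ | Admissible N p.1 p.2}.Finite :=
    ((Set.finite_Iic N).prod (Set.finite_Iic N)).subset fun p ⟨_, h2, h3⟩ => by
      simp only [Set.mem_prod, Set.mem_Iic]; omega
  obtain ⟨p, hp, hmax⟩ := hfin.exists_maximalFor (fun p => winProb θ N p.1 p.2) _
    ⟨(1, 1), le_rfl, le_rfl, by omega⟩
  exact ⟨p.1, p.2, hp, fun j₁ j₂ hj =>
    (le_total _ _).elim id fun h => hmax (j := (j₁, j₂)) hj h⟩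

theorem exists_eventually_isBestThresholds {θ : ℝ} (h₀ : 0 < θ) (h₁ : θ < 1) :
    ∃ x y : ℕ, 2 ≤ y ∧ y ≤ x ∧ ∀ᶠ N : ℕ in atTop, IsBestThresholds θ N (N - x) (N - y) := by
  obtain ⟨C, hC⟩ := exists_bound_of_isBestThresholds h₀ h₁
  -- Every best pair has both distances to `N` at most `C`; the margin ensures that `(2, 2)` lies in
  -- the box even when `C` is small.
  let s : Finset (ℕ × ℕ) :=
    (Finset.range (C + 3) ×ˢ Finset.range (C + 3)).filter fun p => 2 ≤ p.2 ∧ p.2 ≤ p.1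
  have hs : ∀ p, p ∈ s ↔ (p.1 < C + 3 ∧ p.2 < C + 3) ∧ 2 ≤ p.2 ∧ p.2 ≤ p.1 := by simp [s]
  obtain ⟨p, hp, hmax⟩ := exists_eventually_forall_le (s := s) ⟨(2, 2), by rw [hs]; simp⟩
    (fun p N => winProb θ N (N - p.1) (N - p.2)) fun i hi j hj =>
      winProb_eventually_le_or_le h₀ h₁ ((hs i).1 hi).2.2 ((hs j).1 hj).2.2
  have hp' := (hs p).1 hp
  refine ⟨p.1, p.2, hp'.2.1, hp'.2.2, ?_⟩
  filter_upwards [hmax, eventually_ge_atTop (C + 4)] with N hN hNC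
  refine ⟨⟨by omega, by omega, by omega⟩, fun j₁ j₂ hj => ?_⟩
  -- Some best pair for this `N` exists and lies in the box, so the eventual maximizer of the box
  -- does at least as well as every admissible pair.
  obtain ⟨k₁, k₂, hk⟩ := exists_isBestThresholds θ (N := N) (by omega)
  have hb := hC N k₁ k₂ hk
  obtain ⟨h1, h2, h3⟩ := hk.1
  have h := hN (N - k₁, N - k₂) ((hs _).2 (by simp only; omega))
  simp only [show N - (N - k₁) = k₁ by omega, show N - (N - k₂) = k₂ by omega] at h
  exact (hk.2 j₁ j₂ hj).trans h

theorem mainTheorem3 (θ : ℝ) (hθ₀ : 1 / 2 < θ) (hθ₁ : θ < 1) :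
    (∃ C : ℕ, ∀ N k₁ k₂ : ℕ, IsBestThresholds θ N k₁ k₂ → N ≤ k₁ + C ∧ N ≤ k₂ + C) ∧
    (∃ x y : ℕ, 2 ≤ y ∧ y ≤ x ∧
      ∀ᶠ N : ℕ in atTop, IsBestThresholds θ N (N - x) (N - y)) ∧
    (∀ x y : ℕ, 2 ≤ y → y ≤ x →
      Tendsto (fun N : ℕ => winProb θ N (N - x) (N - y)) atTop
        (𝓝 (limitWinProb θ (x : ℤ) (y : ℤ)))) := by
  have h₀ : 0 < θ := by linarith
  exact ⟨exists_bound_of_isBestThresholds h₀ hθ₁, exists_eventually_isBestThresholds h₀ hθ₁,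
    fun x y _ hyx => tendsto_winProb h₀ hθ₁ hyx⟩
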